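/- Let $G$ be a finite simple undirected graph. An EPG representation of $G$ assigns to every vertex $u$ of $G$ a finite path $P(u)$ that consists of one or more consecutive edges of the rectangular grid in the plane, using no grid edge twice, such that two distinct vertices $u$ and $v$ are adjacent in $G$ if and only if $P(u)$ and $P(v)$ share at least one grid edge. A bend of a path is a horizontal edge of the path that is followed by a vertical one, or a vertical edge that is followed by a horizontal one. The bend-number $b(G)$ is the minimum $k$ such that $G$ has an EPG representation in which every path has at most $k$ bends. **Theorem.** If $G$ has treewidth $\mathrm{tw}(G)\le 2$, then $b(G)\le 2$. -/

import Mathlib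

/-- A tree decomposition of a graph `G`: a finite tree with a bag of vertices at every node, such
that every vertex lies in a bag, the two ends of every edge lie together in a bag, and the nodes
whose bags contain a given vertex induce a connected subgraph of the tree. -/
structure TreeDecomposition {V : Type*} (G : SimpleGraph V) where
  /-- the nodes of the tree -/
  Node : Type
  finite_node : Finite Node
  tree : SimpleGraph Node
  isTree : tree.IsTree
  bag : Node → Finset V
  exists_mem_bag : ∀ v : V, ∃ i, v ∈ bag i
  exists_mem_bag_of_adj : ∀ u v : V, G.Adj u v → ∃ i, u ∈ bag i ∧ v ∈ bag i
  connected : ∀ v : V, (tree.induce {i | v ∈ bag i}).Connected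

/-- The width of a tree decomposition: the maximal size of a bag, minus one.
(The truncated subtraction matters only if all bags are empty, that is, for the graph without
vertices, whose treewidth is `0` here instead of `-1`.) -/
noncomputable def TreeDecomposition.width {V : Type*} {G : SimpleGraph V}
    (D : TreeDecomposition G) : ℕ∞ :=
  ⨆ i : D.Node, (((D.bag i).card - 1 : ℕ) : ℕ∞)

/-- The treewidth of a graph: the minimal width of its tree decompositions. -/
noncomputable def treewidth {V : Type*} (G : SimpleGraph V) : ℕ∞ :=
  ⨅ D : TreeDecomposition G, D.width

/-- The rectangular grid in the plane: the points of `ℤ × ℤ`, two of them being joined by a grid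
edge if they agree in one coordinate and differ by `1` in the other. -/
def grid : SimpleGraph (ℤ × ℤ) where
  Adj p q := |p.1 - q.1| + |p.2 - q.2| = 1
  symm := ⟨fun p q h => by rwa [abs_sub_comm q.1, abs_sub_comm q.2]⟩
  loopless := ⟨fun p => by simp⟩

/-- A path in the grid: a finite nonempty sequence of consecutive grid edges that uses no grid edge
twice (it may visit a grid point more than once). -/
structure GridPath where
  source : ℤ × ℤ
  target : ℤ × ℤ
  walk : grid.Walk source target
  isTrail : walk.IsTrail
  not_nil : ¬ walk.Nil

/-- The directions of the successive grid edges of a path: `true` for a horizontal edge and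
`false` for a vertical one. -/
def GridPath.directions (P : GridPath) : List Bool :=
  P.walk.darts.map fun d => decide (d.fst.2 = d.snd.2)

/-- The number of bends of a path: the number of pairs of consecutive edges of the path one of
which is horizontal and the other vertical. -/
def GridPath.bends (P : GridPath) : ℕ :=
  (P.directions.zip P.directions.tail).countP fun q => decide (q.1 ≠ q.2)

/-- An EPG representation of `G`: a path in the grid for every vertex, such that two distinct
vertices are adjacent if and only if their paths share a grid edge. -/
structure EPGRepresentation {V : Type*} (G : SimpleGraph V) where
  path : V → GridPath
  adj_iff : ∀ u v : V, u ≠ v →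
    (G.Adj u v ↔ ∃ e, e ∈ (path u).walk.edges ∧ e ∈ (path v).walk.edges)

/-- `G` is a `k`-bend graph: it has an EPG representation by paths with at most `k` bends each. -/
def IsBendGraph {V : Type*} (k : ℕ) (G : SimpleGraph V) : Prop :=
  ∃ R : EPGRepresentation G, ∀ v : V, (R.path v).bends ≤ k

/-- The bend-number of `G`: the minimal `k` such that `G` is a `k`-bend graph (`⊤` if there is no
such `k`). -/
noncomputable def bendNumber {V : Type*} (G : SimpleGraph V) : ℕ∞ :=
  ⨅ (k : ℕ) (_ : IsBendGraph k G), (k : ℕ∞)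

/-! Along a tree decomposition with bags of size at most three, the vertices can be placed one by
one so that the earlier neighbours of a new vertex `y` lie in a pair `u`, `x` of linked placed
vertices; afterwards `u`, `y` and `x`, `y` are linked as well. The paths are built in this order,
all of them zigzags (three segments, two bends) with rational coordinates, so that new lines and
subintervals are always available. The invariant is that every linked pair has room: reserved
stretches of its two paths, labelled with the pair by `own`, so that work in one room leaves the
others intact.

Two shapes of room suffice. In a room with facing strips, if `y` meets at most one of `u`, `x`, its
path starts with a stub on the right strip (or on an unused line) and then runs on a new line
parallel to both strips; cutting the interval in three gives facing rooms for all three pairs. If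
`y` meets both, it runs along `u`, crosses over and runs along `x`. Its only private part is then
the crossing segment, perpendicular to the strips, so the two new pairs get rooms of the second
shape. In such a room there is a strip for every nonempty set that `y` may have to meet, the shared
strip serving `{u, x}`. After a stub there, the middle and the last segment of `y` run parallel to
one private strip each, and the new pairs get facing rooms again.

`IsRoomy.isExtendable` collects these cases, `HasLayout.add_vertex` preserves the invariant, and
`TreeDecomposition.HasLayout.add_node` does one bag. Finally only the order of the finitely many
coordinates matters, so `isBendGraph_two_of_zigzags` moves them to integers. Segments are half-open,
so that segments that merely touch share no cell and the integer cells correspond to grid edges. -/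

/-! ### Zigzags and their cells. -/

/-- A rectilinear path with three segments: from its start at position `s` along the line `c` of
direction `o` to the position `r`, then along the perpendicular line `r` to the line `d`, and then
along `d` to the position `t`. -/
structure Zigzag (α : Type*) where
  o : Bool
  c : α
  s : α
  r : α
  d : α
  t : α

/-- No segment of the path is degenerate, and its two parallel segments are on distinct lines. -/
def Zigzag.Proper {α : Type*} (P : Zigzag α) : Prop :=
  P.c ≠ P.d ∧ P.s ≠ P.r ∧ P.r ≠ P.t

/-- The half-open segment between the positions `a` and `b` on the line `l` of direction `o`. -/
def lineSegment {α : Type*} [LinearOrder α] (o : Bool) (l a b : α) : Set (Bool × α × α) :=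
  {z | z.1 = o ∧ z.2.1 = l ∧ min a b ≤ z.2.2 ∧ z.2.2 < max a b}

/-- The union of the three segments of a zigzag. -/
def Zigzag.cells {α : Type*} [LinearOrder α] (P : Zigzag α) : Set (Bool × α × α) :=
  lineSegment P.o P.c P.s P.r ∪ lineSegment (!P.o) P.r P.c P.d ∪ lineSegment P.o P.d P.r P.t

/-! ### Strips, rooms and labels. -/

section Strips

variable {W : Type*}

/-- The positions from `a` to `b` on a line all belong to `q`, and the members of `S` that occupy
them are exactly those in `A`. -/
def IsStrip (C : W → Set (Bool × ℚ × ℚ)) (S : Set W) (own : Bool × ℚ × ℚ → W × W) (q : W × W)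
    (o : Bool) (A : Set W) (l a b : ℚ) : Prop :=
  a < b ∧ ∀ z, a ≤ z → z < b → own (o, l, z) = q ∧ ∀ v ∈ S, ((o, l, z) ∈ C v ↔ v ∈ A)

/-- The room that is reserved for further vertices whose neighbours are among `u` and `x`: either
two parallel facing strips, one private to `u` and one private to `x`, or two perpendicular ones
together with a strip that is shared by `u` and `x`. -/
def IsRoomy (C : W → Set (Bool × ℚ × ℚ)) (S : Set W) (own : Bool × ℚ × ℚ → W × W) (q : W × W)
    (u x : W) : Prop :=
  (∃ o l l' a b, IsStrip C S own q o {u} l a b ∧ IsStrip C S own q o {x} l' a b) ∨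
  (∃ o o' l l' l'' a b a' b' a'' b'', IsStrip C S own q o {u} l a b ∧
    IsStrip C S own q (!o) {x} l' a' b' ∧ IsStrip C S own q o' {u, x} l'' a'' b'')

variable {C : W → Set (Bool × ℚ × ℚ)} {S : Set W} {own : Bool × ℚ × ℚ → W × W} {q : W × W}

theorem IsRoomy.swap {u x : W} (h : IsRoomy C S own q u x) : IsRoomy C S own q x u := by
  rcases h with ⟨o, l, l', a, b, h, h'⟩ | ⟨o, o', l, l', l'', a, b, a', b', a'', b'', h, h', h''⟩
  · exact .inl ⟨o, l', l, a, b, h', h⟩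
  · refine .inr ⟨!o, o', l', l, l'', a', b', a, b, a'', b'', h', ?_, ?_⟩
    · simpa using h
    · rwa [Set.pair_comm]

theorem IsStrip.mono {o : Bool} {A : Set W} {l a b a' b' : ℚ} (h : IsStrip C S own q o A l a b)
    (ha : a ≤ a') (hab : a' < b') (hb : b' ≤ b) : IsStrip C S own q o A l a' b' :=
  ⟨hab, fun z hz hz' => h.2 z (ha.trans hz) (hz'.trans_le hb)⟩

open Classical in
theorem isStrip_update {y : W} (hy : y ∉ S) {Y : Set (Bool × ℚ × ℚ)}
    {own' : Bool × ℚ × ℚ → W × W} {q' : W × W} {o : Bool} {A : Set W} {l a b : ℚ} (hab : a < b)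
    (h : ∀ z, a ≤ z → z < b → own' (o, l, z) = q' ∧ (∀ v ∈ S, ((o, l, z) ∈ C v ↔ v ∈ A)) ∧
      ((o, l, z) ∈ Y ↔ y ∈ A)) :
    IsStrip (Function.update C y Y) (insert y S) own' q' o A l a b := by
  refine ⟨hab, fun z hz hz' => ⟨(h z hz hz').1, ?_⟩⟩
  intro v hv
  rcases Set.mem_insert_iff.1 hv with rfl | hv
  · simpa using (h z hz hz').2.2
  · have : v ≠ y := fun e => hy (e ▸ hv)
    simpa [Function.update_of_ne this] using (h z hz hz').2.1 v hv

open Classical in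
-- By `hA` every cell of the strip is occupied by a member of `S`, so it is enough that `H` protects
-- occupied cells. Unoccupied cells may be relabelled freely, which allows the use of fresh lines
-- whatever their label.
theorem IsStrip.update {y : W} (hy : y ∉ S) {Y : Set (Bool × ℚ × ℚ)}
    {own' : Bool × ℚ × ℚ → W × W} {o : Bool} {A : Set W} {l a b : ℚ}
    (h : IsStrip C S own q o A l a b) (hA : ∃ v ∈ S, v ∈ A) (hyA : y ∉ A)
    (H : ∀ z, own z = q → (∃ v ∈ S, z ∈ C v) → own' z = q ∧ z ∉ Y) :
    IsStrip (Function.update C y Y) (insert y S) own' q o A l a b := by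
  refine isStrip_update hy h.1 fun z hz hz' => ?_
  obtain ⟨v, hv, hvA⟩ := hA
  obtain ⟨h1, h2⟩ := h.2 z hz hz'
  obtain ⟨h3, h4⟩ := H _ h1 ⟨v, hv, (h2 v hv).2 hvA⟩
  exact ⟨h3, h2, by simp [h4, hyA]⟩

open Classical in
theorem IsRoomy.update {y u x : W} (hy : y ∉ S) {Y : Set (Bool × ℚ × ℚ)}
    {own' : Bool × ℚ × ℚ → W × W} (h : IsRoomy C S own q u x) (hu : u ∈ S) (hx : x ∈ S)
    (H : ∀ z, own z = q → (∃ v ∈ S, z ∈ C v) → own' z = q ∧ z ∉ Y) :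
    IsRoomy (Function.update C y Y) (insert y S) own' q u x := by
  have hyu : y ≠ u := fun e => hy (e ▸ hu)
  have hyx : y ≠ x := fun e => hy (e ▸ hx)
  rcases h with ⟨o, l, l', a, b, h, h'⟩ | ⟨o, o', l, l', l'', a, b, a', b', a'', b'', h, h', h''⟩
  · exact .inl ⟨o, l, l', a, b, h.update hy ⟨u, hu, rfl⟩ hyu H, h'.update hy ⟨x, hx, rfl⟩ hyx H⟩
  · exact .inr ⟨o, o', l, l', l'', a, b, a', b', a'', b'', h.update hy ⟨u, hu, rfl⟩ hyu H,
      h'.update hy ⟨x, hx, rfl⟩ hyx H, h''.update hy ⟨u, hu, by simp⟩ (by simp [hyu, hyx]) H⟩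

/-! ### Adding one vertex inside a room. -/

/-- A line that is not used by any member of `S`. -/
def IsFresh (C : W → Set (Bool × ℚ × ℚ)) (S : Set W) (o : Bool) (l : ℚ) : Prop :=
  ∀ v ∈ S, ∀ z, (o, l, z) ∉ C v

open Classical in
/-- A proper zigzag for the new vertex `y` that meets exactly the members `A` of `S` can be added
within the room of `u` and `x`, leaving room for `u` and `x`, for `u` and `y`, and for `x` and
`y`. -/
def IsExtendable (C : W → Set (Bool × ℚ × ℚ)) (S : Set W) (own : Bool × ℚ × ℚ → W × W)
    (q : W × W) (y : W) (A : Set W) (q₁ q₂ : W × W) (u x : W) : Prop :=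
  ∃ (P : Zigzag ℚ) (own' : Bool × ℚ × ℚ → W × W), P.Proper ∧
    (∀ z, own z ≠ q → (∃ v ∈ S, z ∈ C v) → own' z = own z ∧ z ∉ P.cells) ∧
    (∀ v ∈ S, ((P.cells ∩ C v).Nonempty ↔ v ∈ A)) ∧
    IsRoomy (Function.update C y P.cells) (insert y S) own' q u x ∧
    IsRoomy (Function.update C y P.cells) (insert y S) own' q₁ u y ∧
    IsRoomy (Function.update C y P.cells) (insert y S) own' q₂ x y

theorem IsExtendable.swap {y : W} {A : Set W} {q₁ q₂ : W × W} {u x : W}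
    (h : IsExtendable C S own q y A q₁ q₂ u x) : IsExtendable C S own q y A q₂ q₁ x u := by
  obtain ⟨P, own', h1, h2, h3, h4, h5, h6⟩ := h
  exact ⟨P, own', h1, h2, h3, h4.swap, h6, h5⟩

theorem mem_cells_iff {o o' : Bool} {c s r d t l z : ℚ} :
    (o', l, z) ∈ (Zigzag.mk o c s r d t).cells ↔
      (o' = o ∧ l = c ∧ min s r ≤ z ∧ z < max s r) ∨ (o' = !o ∧ l = r ∧ min c d ≤ z ∧ z < max c d) ∨
      (o' = o ∧ l = d ∧ min r t ≤ z ∧ z < max r t) := by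
  simp [Zigzag.cells, lineSegment, or_assoc]

open Classical in
/-- Adding a vertex in a room with facing strips, starting on the line `k`. -/
theorem isExtendable_of_facing_of_stub (hfin : ∀ o, {l | ¬ IsFresh C S o l}.Finite) {y : W}
    (hy : y ∉ S) {u x : W} (hu : u ∈ S) (hx : x ∈ S) (A : Set W) (q₁ q₂ : W × W)
    {o : Bool} {l l' k a b m : ℚ} (h : IsStrip C S own q o {u} l a b)
    (h' : IsStrip C S own q o {x} l' a b) (ham : a < m) (hmb : m < b)
    (hk : ∀ z, a ≤ z → z < m → ∀ v ∈ S, ((o, k, z) ∈ C v ↔ v ∈ A))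
    (hk' : (∀ z, a ≤ z → z < m → own (o, k, z) = q) ∨ IsFresh C S o k) :
    IsExtendable C S own q y A q₁ q₂ u x := by
  have hyu : y ≠ u := fun e => hy (e ▸ hu)
  have hyx : y ≠ x := fun e => hy (e ▸ hx)
  obtain ⟨r, ⟨har, hrm⟩, hr⟩ := (Set.Ioo_infinite ham).exists_notMem_finite (hfin (!o))
  obtain ⟨d, hd⟩ := ((hfin o).union (Set.finite_singleton k)).exists_notMem
  simp only [Set.mem_union, Set.mem_ofPred_eq, Set.mem_singleton_iff, not_or, not_not] at hr hd
  obtain ⟨hd, hdk⟩ := hd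
  obtain ⟨m₂, hm, hm₂⟩ := exists_between hmb
  obtain ⟨m₃, hm₃, hm₃b⟩ := exists_between hm₂
  have hl : l ≠ d := by
    rintro rfl
    exact hd u hu a (((h.2 a le_rfl h.1).2 u hu).2 rfl)
  have hl' : l' ≠ d := by
    rintro rfl
    exact hd x hx a (((h'.2 a le_rfl h.1).2 x hx).2 rfl)
  have hcell : ∀ e i z, (e, i, z) ∈ (Zigzag.mk o k a r d b).cells ↔
      (e = o ∧ i = k ∧ a ≤ z ∧ z < r) ∨ (e = !o ∧ i = r ∧ min k d ≤ z ∧ z < max k d) ∨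
      (e = o ∧ i = d ∧ r ≤ z ∧ z < b) := by
    intro e i z
    rw [mem_cells_iff, min_eq_left har.le, max_eq_right har.le, min_eq_left (show r ≤ b by linarith),
      max_eq_right (show r ≤ b by linarith)]
  refine ⟨⟨o, k, a, r, d, b⟩, fun z =>
    if z.1 = o ∧ (z.2.1 = l ∨ z.2.1 = d) ∧ m ≤ z.2.2 ∧ z.2.2 < m₂ then q₁ else
    if z.1 = o ∧ (z.2.1 = l' ∨ z.2.1 = d) ∧ m₂ ≤ z.2.2 ∧ z.2.2 < m₃ then q₂ else own z,
    ⟨Ne.symm hdk, har.ne, by dsimp; linarith⟩, ?_, ?_, .inl ⟨o, l, l', m₃, b, ?_, ?_⟩,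
    .inl ⟨o, l, d, m, m₂, ?_, ?_⟩, .inl ⟨o, l', d, m₂, m₃, ?_, ?_⟩⟩
  · rintro ⟨e, i, z⟩ hz ⟨v, hv, hvz⟩
    refine ⟨?_, ?_⟩
    · dsimp only
      rw [if_neg, if_neg]
      · rintro ⟨rfl, rfl | rfl, h1, h2⟩
        · exact hz (h'.2 z (by linarith) (by linarith)).1
        · exact hd v hv z hvz
      · rintro ⟨rfl, rfl | rfl, h1, h2⟩
        · exact hz (h.2 z (by linarith) (by linarith)).1
        · exact hd v hv z hvz
    · rw [hcell]
      rintro (⟨rfl, rfl, h1, h2⟩ | ⟨rfl, rfl, h1⟩ | ⟨rfl, rfl, h1⟩)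
      · rcases hk' with hk' | hk'
        · exact hz (hk' z h1 (by linarith))
        · exact hk' v hv z hvz
      · exact hr v hv z hvz
      · exact hd v hv z hvz
  · intro v hv
    constructor
    · rintro ⟨⟨e, i, z⟩, h1, h2⟩
      rw [hcell] at h1
      rcases h1 with ⟨rfl, rfl, h1, h3⟩ | ⟨rfl, rfl, h1⟩ | ⟨rfl, rfl, h1⟩
      · exact (hk z h1 (by linarith) v hv).1 h2
      · exact (hr v hv z h2).elim
      · exact (hd v hv z h2).elim
    · intro hvA
      exact ⟨(o, k, a), (hcell _ _ _).2 (.inl ⟨rfl, rfl, le_rfl, har⟩),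
        (hk a le_rfl ham v hv).2 hvA⟩
  · refine isStrip_update hy hm₃b fun z hz hz' => ?_
    obtain ⟨h1, h2⟩ := h.2 z (by linarith) hz'
    refine ⟨?_, h2, ?_⟩
    · simp only
      rw [if_neg, if_neg, h1]
      · rintro ⟨-, -, -, h3⟩; linarith
      · rintro ⟨-, -, -, h3⟩; linarith
    · simp only [hcell, Set.mem_singleton_iff, hyu, iff_false]
      rintro (⟨-, -, -, h3⟩ | ⟨h3, -⟩ | ⟨-, h3, -⟩)
      · linarith
      · simp at h3
      · exact hl h3
  · refine isStrip_update hy hm₃b fun z hz hz' => ?_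
    obtain ⟨h1, h2⟩ := h'.2 z (by linarith) hz'
    refine ⟨?_, h2, ?_⟩
    · simp only
      rw [if_neg, if_neg, h1]
      · rintro ⟨-, -, -, h3⟩; linarith
      · rintro ⟨-, -, -, h3⟩; linarith
    · simp only [hcell, Set.mem_singleton_iff, hyx, iff_false]
      rintro (⟨-, -, -, h3⟩ | ⟨h3, -⟩ | ⟨-, h3, -⟩)
      · linarith
      · simp at h3
      · exact hl' h3
  · refine isStrip_update hy hm fun z hz hz' => ?_
    obtain ⟨h1, h2⟩ := h.2 z (by linarith) (by linarith)
    refine ⟨by simp [hz, hz'], h2, ?_⟩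
    simp only [hcell, Set.mem_singleton_iff, hyu, iff_false]
    rintro (⟨-, -, -, h3⟩ | ⟨h3, -⟩ | ⟨-, h3, -⟩)
    · linarith
    · simp at h3
    · exact hl h3
  · refine isStrip_update hy hm fun z hz hz' => ⟨by simp [hz, hz'], fun v hv => ?_, ?_⟩
    · have : v ≠ y := fun e => hy (e ▸ hv)
      simp [hd v hv z, this]
    · simp only [hcell, Set.mem_singleton_iff, iff_true]
      exact .inr (.inr ⟨trivial, trivial, by linarith, by linarith⟩)
  · refine isStrip_update hy hm₃ fun z hz hz' => ?_
    obtain ⟨h1, h2⟩ := h'.2 z (by linarith) (by linarith)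
    refine ⟨by simp [hz, hz', hz.not_gt], h2, ?_⟩
    simp only [hcell, Set.mem_singleton_iff, hyx, iff_false]
    rintro (⟨-, -, -, h3⟩ | ⟨h3, -⟩ | ⟨-, h3, -⟩)
    · linarith
    · simp at h3
    · exact hl' h3
  · refine isStrip_update hy hm₃ fun z hz hz' =>
      ⟨by simp [hz, hz', hz.not_gt], fun v hv => ?_, ?_⟩
    · have : v ≠ y := fun e => hy (e ▸ hv)
      simp [hd v hv z, this]
    · simp only [hcell, Set.mem_singleton_iff, iff_true]
      exact .inr (.inr ⟨trivial, trivial, by linarith, by linarith⟩)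

open Classical in
/-- Adding a vertex that meets both `u` and `x` in a room with facing strips. -/
theorem isExtendable_of_facing_of_pair (hfin : ∀ o, {l | ¬ IsFresh C S o l}.Finite) {y : W}
    (hy : y ∉ S) {u x : W} (hu : u ∈ S) (hx : x ∈ S) (hux : u ≠ x) (q₁ q₂ : W × W)
    {o : Bool} {l l' a b : ℚ} (h : IsStrip C S own q o {u} l a b)
    (h' : IsStrip C S own q o {x} l' a b) :
    IsExtendable C S own q y {u, x} q₁ q₂ u x := by
  have hyu : y ≠ u := fun e => hy (e ▸ hu)
  have hyx : y ≠ x := fun e => hy (e ▸ hx)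
  have hvy : ∀ v ∈ S, v ≠ y := fun v hv e => hy (e ▸ hv)
  obtain ⟨m₃, hm₃, hm₃b⟩ := exists_between h.1
  obtain ⟨m₂, hm₂, hm₂₃⟩ := exists_between hm₃
  obtain ⟨m, ham, hm⟩ := exists_between hm₂
  obtain ⟨r, ⟨har, hrm⟩, hr⟩ := (Set.Ioo_infinite ham).exists_notMem_finite (hfin (!o))
  simp only [Set.mem_ofPred_eq, not_not] at hr
  have hl : l ≠ l' := by
    rintro rfl
    exact hux (((h'.2 a le_rfl h.1).2 u hu).1 (((h.2 a le_rfl h.1).2 u hu).2 rfl))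
  obtain ⟨n, hn, hn'⟩ := exists_between (min_lt_max.2 hl)
  have hcell : ∀ e i z, (e, i, z) ∈ (Zigzag.mk o l a r l' m).cells ↔
      (e = o ∧ i = l ∧ a ≤ z ∧ z < r) ∨ (e = !o ∧ i = r ∧ min l l' ≤ z ∧ z < max l l') ∨
      (e = o ∧ i = l' ∧ r ≤ z ∧ z < m) := by
    intro e i z
    rw [mem_cells_iff, min_eq_left har.le, max_eq_right har.le, min_eq_left hrm.le,
      max_eq_right hrm.le]
  -- `y` shares `[a, r)` with `u` and `[r, m)` with `x`. Its private crossing segment on the line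
  -- `r` is cut at `n` into one strip for each new pair; the private strips of `u` and `x` are their
  -- stretches `[m, m₃)`, and `[m₃, b)` remains a facing room.
  refine ⟨⟨o, l, a, r, l', m⟩, fun z =>
    if (z.1 = o ∧ z.2.1 = l ∧ a ≤ z.2.2 ∧ z.2.2 < m₃) ∨ (z.1 = !o ∧ z.2.1 = r ∧ z.2.2 < n)
    then q₁ else
    if (z.1 = o ∧ z.2.1 = l' ∧ a ≤ z.2.2 ∧ z.2.2 < m₃) ∨ (z.1 = !o ∧ z.2.1 = r) then q₂
    else own z, ⟨hl, har.ne, hrm.ne⟩, ?_, ?_, .inl ⟨o, l, l', m₃, b, ?_, ?_⟩,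
    .inr ⟨o, o, l, r, l, m, m₃, min l l', n, a, r, ?_, ?_, ?_⟩,
    .inr ⟨o, o, l', r, l', m, m₃, n, max l l', r, m, ?_, ?_, ?_⟩⟩
  · rintro ⟨e, i, z⟩ hz ⟨v, hv, hvz⟩
    refine ⟨?_, ?_⟩
    · dsimp only
      rw [if_neg, if_neg]
      · rintro (⟨rfl, rfl, h1, h2⟩ | ⟨rfl, rfl⟩)
        · exact hz (h'.2 z (by linarith) (by linarith)).1
        · exact hr v hv z hvz
      · rintro (⟨rfl, rfl, h1, h2⟩ | ⟨rfl, rfl, -⟩)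
        · exact hz (h.2 z (by linarith) (by linarith)).1
        · exact hr v hv z hvz
    · rw [hcell]
      rintro (⟨rfl, rfl, h1, h2⟩ | ⟨rfl, rfl, h1⟩ | ⟨rfl, rfl, h1, h2⟩)
      · exact hz (h.2 z (by linarith) (by linarith)).1
      · exact hr v hv z hvz
      · exact hz (h'.2 z (by linarith) (by linarith)).1
  · intro v hv
    constructor
    · rintro ⟨⟨e, i, z⟩, h1, h2⟩
      rw [hcell] at h1
      rcases h1 with ⟨rfl, rfl, h1, h3⟩ | ⟨rfl, rfl, h1⟩ | ⟨rfl, rfl, h1, h3⟩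
      · exact .inl (((h.2 z h1 (by linarith)).2 v hv).1 h2)
      · exact (hr v hv z h2).elim
      · exact .inr (((h'.2 z (by linarith) (by linarith)).2 v hv).1 h2)
    · rintro (rfl | hvx)
      · exact ⟨(o, l, a), (hcell _ _ _).2 (.inl ⟨rfl, rfl, le_rfl, har⟩),
          ((h.2 a le_rfl h.1).2 v hv).2 rfl⟩
      · exact ⟨(o, l', r), (hcell _ _ _).2 (.inr (.inr ⟨rfl, rfl, le_rfl, hrm⟩)),
          ((h'.2 r har.le (by linarith)).2 v hv).2 hvx⟩
  · refine isStrip_update hy hm₃b fun z hz hz' => ?_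
    obtain ⟨h1, h2⟩ := h.2 z (by linarith) hz'
    refine ⟨by simp [hl, hz.not_gt, h1], h2, ?_⟩
    simp only [hcell, Set.mem_singleton_iff, hyu, iff_false]
    rintro (⟨-, -, -, h3⟩ | ⟨h3, -⟩ | ⟨-, h3, -⟩)
    · linarith
    · simp at h3
    · exact hl h3
  · refine isStrip_update hy hm₃b fun z hz hz' => ?_
    obtain ⟨h1, h2⟩ := h'.2 z (by linarith) hz'
    refine ⟨by simp [hl.symm, hz.not_gt, h1], h2, ?_⟩
    simp only [hcell, Set.mem_singleton_iff, hyx, iff_false]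
    rintro (⟨-, h3, -⟩ | ⟨h3, -⟩ | ⟨-, -, -, h3⟩)
    · exact hl h3.symm
    · simp at h3
    · linarith
  · refine isStrip_update hy (by linarith) fun z hz hz' => ?_
    obtain ⟨h1, h2⟩ := h.2 z (by linarith) (by linarith)
    refine ⟨by simp [hz', ham.le.trans hz], h2, ?_⟩
    simp only [hcell, Set.mem_singleton_iff, hyu, iff_false]
    rintro (⟨-, -, -, h3⟩ | ⟨h3, -⟩ | ⟨-, h3, -⟩)
    · linarith
    · simp at h3
    · exact hl h3
  · refine isStrip_update hy hn fun z hz hz' => ⟨by simp [hz'], fun v hv => ?_, ?_⟩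
    · simp [hr v hv z, hvy v hv]
    · simp only [hcell, Set.mem_singleton_iff, iff_true]
      exact .inr (.inl ⟨trivial, trivial, hz, hz'.trans hn'⟩)
  · refine isStrip_update hy har fun z hz hz' => ?_
    obtain ⟨h1, h2⟩ := h.2 z hz (by linarith)
    refine ⟨?_, fun v hv => ?_, ?_⟩
    · have : z < m₃ := by linarith
      simp [hz, this]
    · simp [h2 v hv, hvy v hv]
    · simp [hcell, hz, hz']
  · refine isStrip_update hy (by linarith) fun z hz hz' => ?_
    obtain ⟨h1, h2⟩ := h'.2 z (by linarith) (by linarith)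
    refine ⟨by simp [hl.symm, hz', ham.le.trans hz], h2, ?_⟩
    simp only [hcell, Set.mem_singleton_iff, hyx, iff_false]
    rintro (⟨-, h3, -⟩ | ⟨h3, -⟩ | ⟨-, -, -, h3⟩)
    · exact hl h3.symm
    · simp at h3
    · linarith
  · refine isStrip_update hy hn' fun z hz hz' => ⟨by simp [hz.not_gt], fun v hv => ?_, ?_⟩
    · simp [hr v hv z, hvy v hv]
    · simp only [hcell, Set.mem_singleton_iff, iff_true]
      exact .inr (.inl ⟨trivial, trivial, hn.le.trans hz, hz'⟩)
  · refine isStrip_update hy hrm fun z hz hz' => ?_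
    obtain ⟨h1, h2⟩ := h'.2 z (by linarith) (by linarith)
    refine ⟨?_, fun v hv => ?_, ?_⟩
    · have : z < m₃ := by linarith
      simp [hl.symm, har.le.trans hz, this]
    · simp [h2 v hv, hvy v hv]
    · simp [hcell, hz, hz']

/-- Part of an interval is covered by a segment that starts at `r` and ends outside of `F`. -/
theorem exists_covering_segment {a b : ℚ} (hab : a < b) (r : ℚ) {F : Set ℚ} (hF : F.Finite) :
    ∃ t α β γ δ : ℚ, t ∉ F ∧ t ≠ r ∧ a ≤ α ∧ α < β ∧ β ≤ b ∧ a ≤ γ ∧ γ < δ ∧ δ ≤ b ∧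
      (β ≤ γ ∨ δ ≤ α) ∧ min r t ≤ α ∧ β ≤ max r t := by
  -- As `r` may lie anywhere, only the part of the interval on the other side of `m` is sure to be
  -- coverable; the part on the side of `r` is returned as `[γ, δ)`.
  obtain ⟨m, ham, hmb⟩ := exists_between hab
  rcases le_total r m with h | h
  · obtain ⟨t, ht, htF⟩ := (Set.Ioi_infinite b).exists_notMem_finite hF
    have ht : b < t := ht
    exact ⟨t, m, b, a, m, htF, by linarith, ham.le, hmb, le_rfl, le_rfl, ham, hmb.le,
      .inr le_rfl, min_le_of_left_le h, le_max_of_le_right ht.le⟩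
  · obtain ⟨t, ht, htF⟩ := (Set.Iio_infinite a).exists_notMem_finite hF
    have ht : t < a := ht
    exact ⟨t, a, m, m, b, htF, by linarith, le_rfl, ham, hmb.le, ham.le, hmb, le_rfl,
      .inl le_rfl, min_le_of_right_le ht.le, le_max_of_le_left h⟩

open Classical in
/-- Adding a vertex in a room with perpendicular strips, starting on the line `k`. -/
theorem isExtendable_of_perpendicular_of_stub (hfin : ∀ o, {l | ¬ IsFresh C S o l}.Finite) {y : W}
    (hy : y ∉ S) {u x : W} (hu : u ∈ S) (hx : x ∈ S) (hux : u ≠ x) (A : Set W) (q₁ q₂ : W × W)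
    {o o' : Bool} {l l' l'' k a b a' b' a'' b'' i j : ℚ}
    (h : IsStrip C S own q o {u} l a b) (h' : IsStrip C S own q (!o) {x} l' a' b')
    (h'' : IsStrip C S own q o' {u, x} l'' a'' b'') (hij : i < j)
    (hk : ∀ z, i ≤ z → z < j → ∀ v ∈ S, ((o, k, z) ∈ C v ↔ v ∈ A))
    (hk' : (∀ z, i ≤ z → z < j → own (o, k, z) = q) ∨ IsFresh C S o k)
    (hd₁ : ∀ z, a ≤ z → z < b → i ≤ z → z < j → l ≠ k)
    (hd₂ : ∀ z, a'' ≤ z → z < b'' → i ≤ z → z < j → l'' = k → o' ≠ o) :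
    IsExtendable C S own q y A q₁ q₂ u x := by
  have hyu : y ≠ u := fun e => hy (e ▸ hu)
  have hyx : y ≠ x := fun e => hy (e ▸ hx)
  have hvy : ∀ v ∈ S, v ≠ y := fun v hv e => hy (e ▸ hv)
  obtain ⟨r, ⟨hir, hrj⟩, hr⟩ := (Set.Ioo_infinite hij).exists_notMem_finite (hfin (!o))
  simp only [Set.mem_ofPred_eq, not_not] at hr
  obtain ⟨t, α, β, γ, δ, -, htr, haα, hαβ, hβb, haγ, hγδ, hδb, hαγ, hrα, hβt⟩ :=
    exists_covering_segment h.1 r Set.finite_empty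
  -- `d` is at once the end position of the middle segment, which must reach along the strip of `x`,
  -- and the line of the last segment, which must be unused. The end `t` above has no such
  -- constraint.
  obtain ⟨d, α', β', γ', δ', hd, hdk, haα', hαβ', hβb', haγ', hγδ', hδb', hαγ', hkα', hβd'⟩ :=
    exists_covering_segment h'.1 k (hfin o)
  simp only [Set.mem_ofPred_eq, not_not] at hd
  have hu' : ∀ z, a ≤ z → z < b → (o, l, z) ∈ C u := fun z hz hz' =>
    ((h.2 z hz hz').2 u hu).2 rfl
  have hx' : ∀ z, a' ≤ z → z < b' → (!o, l', z) ∈ C x := fun z hz hz' =>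
    ((h'.2 z hz hz').2 x hx).2 rfl
  have hux' : ∀ z, a ≤ z → z < b → (o, l, z) ∉ C x := fun z hz hz' hc =>
    hux (((h.2 z hz hz').2 x hx).1 hc).symm
  have hxu' : ∀ z, a' ≤ z → z < b' → (!o, l', z) ∉ C u := fun z hz hz' hc =>
    hux (((h'.2 z hz hz').2 u hu).1 hc)
  have hl : l ≠ d := by
    rintro rfl
    exact hd u hu a (hu' a le_rfl h.1)
  have hl' : l' ≠ r := by
    rintro rfl
    exact hr x hx a' (hx' a' le_rfl h'.1)
  have hcell : ∀ e n z, (e, n, z) ∈ (Zigzag.mk o k i r d t).cells ↔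
      (e = o ∧ n = k ∧ i ≤ z ∧ z < r) ∨ (e = !o ∧ n = r ∧ min k d ≤ z ∧ z < max k d) ∨
      (e = o ∧ n = d ∧ min r t ≤ z ∧ z < max r t) := by
    intro e n z
    rw [mem_cells_iff, min_eq_left hir.le, max_eq_right hir.le]
  have hYu : ∀ z, a ≤ z → z < b → (o, l, z) ∉ (Zigzag.mk o k i r d t).cells := by
    intro z hz hz'
    rw [hcell]
    rintro (⟨-, h1, h2, h3⟩ | ⟨h1, -⟩ | ⟨-, h1, -⟩)
    · exact hd₁ z hz hz' h2 (h3.trans hrj) h1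
    · simp at h1
    · exact hl h1
  have hYx : ∀ z, a' ≤ z → z < b' → (!o, l', z) ∉ (Zigzag.mk o k i r d t).cells := by
    intro z hz hz'
    rw [hcell]
    rintro (⟨h1, -⟩ | ⟨-, h1, -⟩ | ⟨h1, -⟩)
    · simp at h1
    · exact hl' h1
    · simp at h1
  -- The last segment faces the strip of `u` along `[α, β)` and the middle one faces the strip of
  -- `x` along `[α', β')`. The remainders of both strips and the shared strip stay with `u` and `x`.
  refine ⟨⟨o, k, i, r, d, t⟩, fun z =>
    if z.1 = o ∧ (z.2.1 = l ∧ α ≤ z.2.2 ∧ z.2.2 < β ∨ z.2.1 = d) then q₁ else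
    if z.1 = (!o) ∧ (z.2.1 = l' ∧ α' ≤ z.2.2 ∧ z.2.2 < β' ∨ z.2.1 = r) then q₂ else own z,
    ⟨hdk.symm, hir.ne, htr.symm⟩, ?_, ?_,
    .inr ⟨o, o', l, l', l'', γ, δ, γ', δ', a'', b'', ?_, ?_, ?_⟩,
    .inl ⟨o, l, d, α, β, ?_, ?_⟩, .inl ⟨!o, l', r, α', β', ?_, ?_⟩⟩
  · rintro ⟨e, n, z⟩ hz ⟨v, hv, hvz⟩
    refine ⟨?_, ?_⟩
    · dsimp only
      rw [if_neg, if_neg]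
      · rintro ⟨rfl, (⟨rfl, h1, h2⟩ | rfl)⟩
        · exact hz (h'.2 z (by linarith) (by linarith)).1
        · exact hr v hv z hvz
      · rintro ⟨rfl, (⟨rfl, h1, h2⟩ | rfl)⟩
        · exact hz (h.2 z (by linarith) (by linarith)).1
        · exact hd v hv z hvz
    · rw [hcell]
      rintro (⟨rfl, rfl, h1, h2⟩ | ⟨rfl, rfl, h1⟩ | ⟨rfl, rfl, h1⟩)
      · rcases hk' with hk' | hk'
        · exact hz (hk' z h1 (by linarith))
        · exact hk' v hv z hvz
      · exact hr v hv z hvz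
      · exact hd v hv z hvz
  · intro v hv
    constructor
    · rintro ⟨⟨e, i, z⟩, h1, h2⟩
      rw [hcell] at h1
      rcases h1 with ⟨rfl, rfl, h1, h3⟩ | ⟨rfl, rfl, h1⟩ | ⟨rfl, rfl, h1⟩
      · exact (hk z h1 (by linarith) v hv).1 h2
      · exact (hr v hv z h2).elim
      · exact (hd v hv z h2).elim
    · intro hvA
      exact ⟨(o, k, i), (hcell _ _ _).2 (.inl ⟨rfl, rfl, le_rfl, hir⟩),
        (hk i le_rfl hij v hv).2 hvA⟩
  · refine isStrip_update hy hγδ fun z hz hz' => ?_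
    obtain ⟨h1, h2⟩ := h.2 z (by linarith) (by linarith)
    refine ⟨?_, h2, by simp [hYu z (by linarith) (by linarith), hyu]⟩
    have : α ≤ z → β ≤ z := fun h3 => by rcases hαγ with h4 | h4 <;> linarith
    simpa [hl, h1] using fun h3 h4 => absurd (this h3) h4.not_ge
  · refine isStrip_update hy hγδ' fun z hz hz' => ?_
    obtain ⟨h1, h2⟩ := h'.2 z (by linarith) (by linarith)
    refine ⟨?_, h2, by simp [hYx z (by linarith) (by linarith), hyx]⟩
    have : α' ≤ z → β' ≤ z := fun h3 => by rcases hαγ' with h4 | h4 <;> linarith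
    simpa [hl', h1] using fun h3 h4 => absurd (this h3) h4.not_ge
  · refine isStrip_update hy h''.1 fun z hz hz' => ?_
    obtain ⟨h1, h2⟩ := h''.2 z hz hz'
    have hcu : (o', l'', z) ∈ C u := (h2 u hu).2 (by simp)
    have hcx : (o', l'', z) ∈ C x := (h2 x hx).2 (by simp)
    refine ⟨?_, h2, ?_⟩
    · dsimp only
      rw [if_neg, if_neg, h1]
      · rintro ⟨rfl, (⟨rfl, h3, h4⟩ | rfl)⟩
        · exact hxu' z (by linarith) (by linarith) hcu
        · exact hr u hu z hcu
      · rintro ⟨rfl, (⟨rfl, h3, h4⟩ | rfl)⟩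
        · exact hux' z (by linarith) (by linarith) hcx
        · exact hd u hu z hcu
    · simp only [hcell, Set.mem_insert_iff, Set.mem_singleton_iff, hyx, hyu, or_self, iff_false]
      rintro (⟨h3, h4, h5, h6⟩ | ⟨rfl, rfl, -⟩ | ⟨rfl, rfl, -⟩)
      · exact hd₂ z hz hz' h5 (by linarith) h4 h3
      · exact hr u hu z hcu
      · exact hd u hu z hcu
  · refine isStrip_update hy hαβ fun z hz hz' => ?_
    obtain ⟨h1, h2⟩ := h.2 z (by linarith) (by linarith)
    exact ⟨by simp [hz, hz'], h2, by simp [hYu z (by linarith) (by linarith), hyu]⟩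
  · refine isStrip_update hy hαβ fun z hz hz' => ⟨by simp, fun v hv => ?_, ?_⟩
    · simp [hd v hv z, hvy v hv]
    · simp only [hcell, Set.mem_singleton_iff, iff_true]
      exact .inr (.inr ⟨trivial, trivial, hrα.trans hz, hz'.trans_le hβt⟩)
  · refine isStrip_update hy hαβ' fun z hz hz' => ?_
    obtain ⟨h1, h2⟩ := h'.2 z (by linarith) (by linarith)
    exact ⟨by simp [hz, hz'], h2, by simp [hYx z (by linarith) (by linarith), hyx]⟩
  · refine isStrip_update hy hαβ' fun z hz hz' => ⟨by simp, fun v hv => ?_, ?_⟩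
    · simp [hr v hv z, hvy v hv]
    · simp only [hcell, Set.mem_singleton_iff, iff_true]
      exact .inr (.inl ⟨trivial, trivial, hkα'.trans hz, hz'.trans_le hβd'⟩)

theorem IsFresh.mem_iff {o : Bool} {k : ℚ} (hk : IsFresh C S o k) (z : ℚ) :
    ∀ v ∈ S, ((o, k, z) ∈ C v ↔ v ∈ (∅ : Set W)) := fun v hv => by simp [hk v hv z]

/-- The stub uses an initial part of the private strip of `u`. The rest of it survives, and so does
the shared strip, which cannot overlap the stub because `x` is absent there. -/
theorem isExtendable_of_perpendicular_of_mem (hfin : ∀ o, {l | ¬ IsFresh C S o l}.Finite) {y : W}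
    (hy : y ∉ S) {u x : W} (hu : u ∈ S) (hx : x ∈ S) (hux : u ≠ x) (q₁ q₂ : W × W)
    {o o' : Bool} {l l' l'' a b a' b' a'' b'' : ℚ}
    (h : IsStrip C S own q o {u} l a b) (h' : IsStrip C S own q (!o) {x} l' a' b')
    (h'' : IsStrip C S own q o' {u, x} l'' a'' b'') :
    IsExtendable C S own q y {u} q₁ q₂ u x := by
  obtain ⟨m, ham, hmb⟩ := exists_between h.1
  refine isExtendable_of_perpendicular_of_stub hfin hy hu hx hux {u} q₁ q₂
    (h.mono ham.le hmb le_rfl) h' h'' ham (fun z hz hz' => (h.2 z hz (hz'.trans hmb)).2)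
    (.inl fun z hz hz' => (h.2 z hz (hz'.trans hmb)).1) ?_ ?_
  · intro z h1 h2 h3 h4
    linarith
  · rintro z h1 h2 h3 h4 rfl rfl
    have := ((h''.2 z h1 h2).2 x hx).2 (by simp)
    exact hux (((h.2 z h3 (h4.trans hmb)).2 x hx).1 this).symm

/-- The stub uses an initial part of the shared strip, which must therefore be parallel to the
private strip of `u`. If it is parallel to that of `x` instead, the roles of `u` and `x` are
exchanged. -/
theorem isExtendable_of_perpendicular_of_pair (hfin : ∀ o, {l | ¬ IsFresh C S o l}.Finite) {y : W}
    (hy : y ∉ S) {u x : W} (hu : u ∈ S) (hx : x ∈ S) (hux : u ≠ x) (q₁ q₂ : W × W)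
    {o : Bool} {l l' l'' a b a' b' a'' b'' : ℚ}
    (h : IsStrip C S own q o {u} l a b) (h' : IsStrip C S own q (!o) {x} l' a' b')
    (h'' : IsStrip C S own q o {u, x} l'' a'' b'') :
    IsExtendable C S own q y {u, x} q₁ q₂ u x := by
  obtain ⟨m, ham, hmb⟩ := exists_between h''.1
  refine isExtendable_of_perpendicular_of_stub hfin hy hu hx hux {u, x} q₁ q₂
    h h' (h''.mono ham.le hmb le_rfl) ham (fun z hz hz' => (h''.2 z hz (hz'.trans hmb)).2)
    (.inl fun z hz hz' => (h''.2 z hz (hz'.trans hmb)).1) ?_ ?_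
  · rintro z h1 h2 h3 h4 rfl
    have := ((h''.2 z h3 (h4.trans hmb)).2 x hx).2 (by simp)
    exact hux (((h.2 z h1 h2).2 x hx).1 this).symm
  · intro z h1 h2 h3 h4
    linarith

theorem IsRoomy.isExtendable (hfin : ∀ o, {l | ¬ IsFresh C S o l}.Finite) {y : W}
    (hy : y ∉ S) {u x : W} (hu : u ∈ S) (hx : x ∈ S) (hux : u ≠ x) (h : IsRoomy C S own q u x)
    (A : Set W) (hA : A ⊆ {u, x}) (q₁ q₂ : W × W) : IsExtendable C S own q y A q₁ q₂ u x := by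
  have hcases : A = ∅ ∨ A = {u} ∨ A = {x} ∨ A = {u, x} := Set.subset_pair_iff_eq.1 hA
  rcases h with ⟨o, l, l', a, b, h, h'⟩ | ⟨o, o', l, l', l'', a, b, a', b', a'', b'', h, h', h''⟩
  · obtain ⟨m, ham, hmb⟩ := exists_between h.1
    rcases hcases with rfl | rfl | rfl | rfl
    · obtain ⟨k, hk⟩ := (hfin o).exists_notMem
      simp only [Set.mem_ofPred_eq, not_not] at hk
      exact isExtendable_of_facing_of_stub hfin hy hu hx _ q₁ q₂ h h' ham hmb
        (fun z _ _ => hk.mem_iff z) (.inr hk)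
    · exact isExtendable_of_facing_of_stub hfin hy hu hx _ q₁ q₂ h h' ham hmb
        (fun z hz hz' => (h.2 z hz (hz'.trans hmb)).2)
        (.inl fun z hz hz' => (h.2 z hz (hz'.trans hmb)).1)
    · exact isExtendable_of_facing_of_stub hfin hy hu hx _ q₁ q₂ h h' ham hmb
        (fun z hz hz' => (h'.2 z hz (hz'.trans hmb)).2)
        (.inl fun z hz hz' => (h'.2 z hz (hz'.trans hmb)).1)
    · exact isExtendable_of_facing_of_pair hfin hy hu hx hux q₁ q₂ h h'
  · have hswap : IsStrip C S own q (!!o) {u} l a b := by simpa using h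
    have hpair : IsStrip C S own q o' {x, u} l'' a'' b'' := by rwa [Set.pair_comm]
    rcases hcases with rfl | rfl | rfl | rfl
    · obtain ⟨k, hk⟩ := (hfin o).exists_notMem
      simp only [Set.mem_ofPred_eq, not_not] at hk
      refine isExtendable_of_perpendicular_of_stub hfin hy hu hx hux _ q₁ q₂ h h' h'' zero_lt_one
        (fun z _ _ => hk.mem_iff z) (.inr hk) ?_ ?_
      · rintro z h1 h2 - - rfl
        exact hk u hu z (((h.2 z h1 h2).2 u hu).2 rfl)
      · rintro z h1 h2 - - rfl rfl
        exact hk u hu z (((h''.2 z h1 h2).2 u hu).2 (by simp))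
    · exact isExtendable_of_perpendicular_of_mem hfin hy hu hx hux q₁ q₂ h h' h''
    · exact (isExtendable_of_perpendicular_of_mem hfin hy hx hu hux.symm q₂ q₁ h' hswap
        hpair).swap
    · by_cases ho : o' = o
      · subst ho
        exact isExtendable_of_perpendicular_of_pair hfin hy hu hx hux q₁ q₂ h h' h''
      · obtain rfl : o' = !o := by cases o <;> cases o' <;> simp_all
        rw [Set.pair_comm]
        exact (isExtendable_of_perpendicular_of_pair hfin hy hx hu hux.symm q₂ q₁ h' hswap
          hpair).swap

end Strips

/-! ### Integer zigzags as grid paths. -/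

/-- The grid point at position `z` on the line `l` of direction `o`. -/
def gridPoint (o : Bool) (l z : ℤ) : ℤ × ℤ := bif o then (z, l) else (l, z)

/-- The grid edge that starts at position `z` on the line `l` of direction `o`. -/
def gridEdge (e : Bool × ℤ × ℤ) : Sym2 (ℤ × ℤ) :=
  s(gridPoint e.1 e.2.1 e.2.2, gridPoint e.1 e.2.1 (e.2.2 + 1))

theorem gridEdge_injective : Function.Injective gridEdge := by
  rintro ⟨o, l, z⟩ ⟨o', l', z'⟩ h
  cases o <;> cases o' <;>
    simp only [gridEdge, gridPoint, cond_true, cond_false, Sym2.eq_iff, Prod.mk.injEq,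
      reduceCtorEq, true_and, false_and] at h ⊢ <;>
    omega

theorem grid_adj_gridPoint (o : Bool) (l z : ℤ) :
    grid.Adj (gridPoint o l z) (gridPoint o l (z + 1)) := by
  cases o <;> simp [grid, gridPoint]

/-- The direction of a dart of the grid. -/
def dartDirection (d : grid.Dart) : Bool := decide (d.fst.2 = d.snd.2)

theorem exists_walk_of_le (o : Bool) (l : ℤ) {a b : ℤ} (hab : a ≤ b) :
    ∃ w : grid.Walk (gridPoint o l a) (gridPoint o l b), w.IsTrail ∧
      (∀ e, e ∈ w.edges ↔ ∃ z, a ≤ z ∧ z < b ∧ e = gridEdge (o, l, z)) ∧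
      ∀ d ∈ w.darts, dartDirection d = o := by
  induction b, hab using Int.leInduction with
  | base => exact ⟨.nil, by simp, fun e => by simp; intros; omega, by simp⟩
  | succ b hab ih =>
    obtain ⟨w, h1, h2, h3⟩ := ih
    refine ⟨w.concat (grid_adj_gridPoint o l b), ?_, ?_, ?_⟩
    · rw [SimpleGraph.Walk.isTrail_def, SimpleGraph.Walk.edges_concat, List.concat_eq_append,
        List.nodup_append]
      refine ⟨h1.edges_nodup, by simp, ?_⟩
      rintro e he e' he' rfl
      obtain ⟨z, hz, hz', rfl⟩ := (h2 e).1 he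
      have := gridEdge_injective (a₂ := (o, l, b)) (List.mem_singleton.1 he')
      simp only [Prod.mk.injEq, true_and] at this
      omega
    · intro e
      simp only [SimpleGraph.Walk.edges_concat, List.concat_eq_append, List.mem_append,
        List.mem_singleton, h2]
      constructor
      · rintro (⟨z, hz, hz', rfl⟩ | rfl)
        · exact ⟨z, hz, by omega, rfl⟩
        · exact ⟨b, hab, by omega, rfl⟩
      · rintro ⟨z, hz, hz', rfl⟩
        rcases (show z < b ∨ z = b by omega) with h | rfl
        · exact .inl ⟨z, hz, h, rfl⟩
        · exact .inr rfl
    · intro d hd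
      simp only [SimpleGraph.Walk.darts_concat, List.concat_eq_append, List.mem_append,
        List.mem_singleton] at hd
      rcases hd with hd | rfl
      · exact h3 d hd
      · cases o <;> simp [dartDirection, gridPoint]

theorem exists_straight_walk (o : Bool) (l a b : ℤ) :
    ∃ w : grid.Walk (gridPoint o l a) (gridPoint o l b), w.IsTrail ∧
      (∀ e, e ∈ w.edges ↔ ∃ z ∈ lineSegment o l a b, e = gridEdge z) ∧
      ∀ d ∈ w.darts, dartDirection d = o := by
  rcases le_total a b with h | h
  · obtain ⟨w, h1, h2, h3⟩ := exists_walk_of_le o l h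
    refine ⟨w, h1, fun e => (h2 e).trans ?_, h3⟩
    simp [lineSegment, h, and_assoc]
  · obtain ⟨w, h1, h2, h3⟩ := exists_walk_of_le o l h
    refine ⟨w.reverse, h1.reverse, fun e => ?_, ?_⟩
    · rw [SimpleGraph.Walk.edges_reverse, List.mem_reverse, h2 e]
      simp [lineSegment, h, and_assoc]
    · intro d hd
      have := h3 _ (SimpleGraph.Walk.mem_darts_reverse.1 hd)
      rw [← this]
      simp [dartDirection, eq_comm]

/-- The number of changes in a list of directions. -/
def changes (L : List Bool) : ℕ := (L.zip L.tail).countP fun q => decide (q.1 ≠ q.2)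

theorem changes_cons_cons (a b : Bool) (L : List Bool) :
    changes (a :: b :: L) = changes (b :: L) + if a ≠ b then 1 else 0 := by
  simp [changes, List.countP_cons]

/-- The extra `1` is for the junction; three straight pieces have two junctions, hence at most two
bends. -/
theorem changes_append_le (L M : List Bool) : changes (L ++ M) ≤ changes L + 1 + changes M := by
  induction L with
  | nil => simp
  | cons a L ih =>
    cases L with
    | nil =>
      cases M with
      | nil => simp [changes]
      | cons b M =>
        simp only [List.cons_append, List.nil_append, changes_cons_cons]
        split <;> omega
    | cons b L =>
      simp only [List.cons_append, changes_cons_cons] at ih ⊢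
      omega

theorem changes_eq_zero {L : List Bool} {o : Bool} (h : ∀ a ∈ L, a = o) : changes L = 0 := by
  induction L with
  | nil => rfl
  | cons a L ih =>
    cases L with
    | nil => rfl
    | cons b L =>
      rw [changes_cons_cons, ih fun c hc => h c (List.mem_cons_of_mem _ hc)]
      simp [h a (by simp), h b (by simp)]

theorem disjoint_lineSegment {o o' : Bool} {l l' a b a' b' : ℤ} (h : o ≠ o' ∨ l ≠ l') {e}
    (h1 : ∃ z ∈ lineSegment o l a b, e = gridEdge z)
    (h2 : ∃ z ∈ lineSegment o' l' a' b', e = gridEdge z) : False := by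
  obtain ⟨z, hz, rfl⟩ := h1
  obtain ⟨z', hz', hzz⟩ := h2
  obtain rfl := gridEdge_injective hzz
  rcases h with h | h
  · exact h (hz.1.symm.trans hz'.1)
  · exact h (hz.2.1.symm.trans hz'.2.1)

theorem Zigzag.Proper.exists_gridPath {P : Zigzag ℤ} (hP : P.Proper) :
    ∃ p : GridPath, p.bends ≤ 2 ∧ ∀ e, e ∈ p.walk.edges ↔ ∃ z ∈ P.cells, e = gridEdge z := by
  obtain ⟨o, c, s, r, d, t⟩ := P
  obtain ⟨hcd, hsr, hrt⟩ := hP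
  dsimp only at hcd hsr hrt
  obtain ⟨w₁, ht₁, he₁, hd₁⟩ := exists_straight_walk o c s r
  obtain ⟨w₂, ht₂, he₂, hd₂⟩ :
      ∃ w : grid.Walk (gridPoint o c r) (gridPoint o d r), w.IsTrail ∧
      (∀ e, e ∈ w.edges ↔ ∃ z ∈ lineSegment (!o) r c d, e = gridEdge z) ∧
      ∀ e ∈ w.darts, dartDirection e = !o := by
    -- The corner is position `r` on the line `c` and also position `c` on the perpendicular line
    -- `r`; the two descriptions agree by definition once the direction is known.
    cases o
    exacts [exists_straight_walk true r c d, exists_straight_walk false r c d]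
  obtain ⟨w₃, ht₃, he₃, hd₃⟩ := exists_straight_walk o d r t
  have hedges : ∀ e, e ∈ (w₁.append (w₂.append w₃)).edges ↔
      ∃ z ∈ (Zigzag.mk o c s r d t).cells, e = gridEdge z := by
    intro e
    simp only [SimpleGraph.Walk.edges_append, List.mem_append, he₁, he₂, he₃, Zigzag.cells,
      Set.mem_union]
    constructor
    · rintro (⟨z, hz, rfl⟩ | ⟨z, hz, rfl⟩ | ⟨z, hz, rfl⟩)
      exacts [⟨z, .inl (.inl hz), rfl⟩, ⟨z, .inl (.inr hz), rfl⟩, ⟨z, .inr hz, rfl⟩]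
    · rintro ⟨z, (hz | hz) | hz, rfl⟩
      exacts [.inl ⟨z, hz, rfl⟩, .inr (.inl ⟨z, hz, rfl⟩), .inr (.inr ⟨z, hz, rfl⟩)]
  refine ⟨⟨_, _, w₁.append (w₂.append w₃), ?_, ?_⟩, ?_, hedges⟩
  · rw [SimpleGraph.Walk.isTrail_def, SimpleGraph.Walk.edges_append,
      SimpleGraph.Walk.edges_append, List.nodup_append, List.nodup_append]
    refine ⟨ht₁.edges_nodup, ⟨ht₂.edges_nodup, ht₃.edges_nodup, ?_⟩, ?_⟩
    · rintro e he e' he' rfl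
      exact disjoint_lineSegment (.inl (by simp)) ((he₂ e).1 he) ((he₃ e).1 he')
    · rintro e he e' he' rfl
      rcases List.mem_append.1 he' with h | h
      · exact disjoint_lineSegment (.inl (by simp)) ((he₁ e).1 he) ((he₂ e).1 h)
      · exact disjoint_lineSegment (.inr hcd) ((he₁ e).1 he) ((he₃ e).1 h)
  · intro hnil
    have h0 := SimpleGraph.Walk.edges_eq_nil.2 hnil
    have := (hedges (gridEdge (o, c, min s r))).2
      ⟨_, .inl (.inl ⟨rfl, rfl, le_rfl, min_lt_max.2 hsr⟩), rfl⟩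
    rw [h0] at this
    simp at this
  · have hb : ∀ {u v : ℤ × ℤ} (w : grid.Walk u v) (o : Bool), (∀ e ∈ w.darts, dartDirection e = o) →
        changes (w.darts.map dartDirection) = 0 := by
      intro u v w o h
      refine changes_eq_zero (o := o) fun a ha => ?_
      obtain ⟨e, he, rfl⟩ := List.mem_map.1 ha
      exact h e he
    change changes ((w₁.append (w₂.append w₃)).darts.map dartDirection) ≤ 2
    rw [SimpleGraph.Walk.darts_append, SimpleGraph.Walk.darts_append, List.map_append,
      List.map_append]
    have h1 := changes_append_le (w₁.darts.map dartDirection)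
      (w₂.darts.map dartDirection ++ w₃.darts.map dartDirection)
    have h2 := changes_append_le (w₂.darts.map dartDirection) (w₃.darts.map dartDirection)
    rw [hb w₁ o hd₁] at h1
    rw [hb w₂ _ hd₂, hb w₃ o hd₃] at h2
    omega

/-! ### From rational to integer coordinates. -/

/-- The image of a zigzag under a map of the coordinates. -/
def Zigzag.map {α β : Type*} (f : α → β) (P : Zigzag α) : Zigzag β :=
  ⟨P.o, f P.c, f P.s, f P.r, f P.d, f P.t⟩

/-- All coordinates of the zigzag are in `F`. -/
def Zigzag.IsIn {α : Type*} (P : Zigzag α) (F : Set α) : Prop :=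
  P.c ∈ F ∧ P.s ∈ F ∧ P.r ∈ F ∧ P.d ∈ F ∧ P.t ∈ F

/-- This reduces intersection to equalities and comparisons of coordinates, which a map that is
strictly monotone on the coordinates preserves and reflects. -/
theorem lineSegment_inter_nonempty {α : Type*} [LinearOrder α] {o o' : Bool}
    {l l' a b a' b' : α} : (lineSegment o l a b ∩ lineSegment o' l' a' b').Nonempty ↔
      o = o' ∧ l = l' ∧ min a b < max a b ∧ min a b < max a' b' ∧ min a' b' < max a b ∧
        min a' b' < max a' b' := by
  constructor
  · rintro ⟨⟨e, n, z⟩, ⟨rfl, rfl, h1, h2⟩, ⟨rfl, rfl, h3, h4⟩⟩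
    exact ⟨rfl, rfl, h1.trans_lt h2, h1.trans_lt h4, h3.trans_lt h2, h3.trans_lt h4⟩
  · rintro ⟨rfl, rfl, h1, h2, h3, h4⟩
    exact ⟨(o, l, max (min a b) (min a' b')), ⟨rfl, rfl, le_max_left _ _, max_lt h1 h3⟩,
      ⟨rfl, rfl, le_max_right _ _, max_lt h2 h4⟩⟩

theorem StrictMonoOn.lineSegment_inter {α β : Type*} [LinearOrder α] [LinearOrder β] {f : α → β}
    {F : Set α} (hf : StrictMonoOn f F) {o o' : Bool} {l l' a b a' b' : α} (hl : l ∈ F)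
    (hl' : l' ∈ F) (ha : a ∈ F) (hb : b ∈ F) (ha' : a' ∈ F) (hb' : b' ∈ F) :
    (lineSegment o (f l) (f a) (f b) ∩ lineSegment o' (f l') (f a') (f b')).Nonempty ↔
      (lineSegment o l a b ∩ lineSegment o' l' a' b').Nonempty := by
  simp only [lineSegment_inter_nonempty, min_lt_iff, lt_max_iff, hf.lt_iff_lt, ha, hb, ha', hb',
    hf.injOn.eq_iff hl hl']

theorem Zigzag.inter_map_nonempty {α β : Type*} [LinearOrder α] [LinearOrder β] {f : α → β}
    {F : Set α} (hf : StrictMonoOn f F) {P Q : Zigzag α} (hP : P.IsIn F) (hQ : Q.IsIn F) :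
    ((P.map f).cells ∩ (Q.map f).cells).Nonempty ↔ (P.cells ∩ Q.cells).Nonempty := by
  obtain ⟨h1, h2, h3, h4, h5⟩ := hP
  obtain ⟨k1, k2, k3, k4, k5⟩ := hQ
  simp only [Zigzag.cells, Zigzag.map, Set.union_inter_distrib_right, Set.inter_union_distrib_left,
    Set.union_nonempty, hf.lineSegment_inter, *]

theorem Zigzag.Proper.map {α β : Type*} [LinearOrder α] [LinearOrder β] {f : α → β}
    {F : Set α} (hf : StrictMonoOn f F) {P : Zigzag α} (hP : P.IsIn F) (h : P.Proper) :
    (P.map f).Proper := by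
  obtain ⟨h1, h2, h3, h4, h5⟩ := hP
  obtain ⟨k1, k2, k3⟩ := h
  exact ⟨fun e => k1 (hf.injOn h1 h4 e), fun e => k2 (hf.injOn h2 h3 e),
    fun e => k3 (hf.injOn h3 h5 e)⟩

theorem exists_strictMonoOn_int {α : Type*} [LinearOrder α] {F : Set α} (hF : F.Finite) :
    ∃ f : α → ℤ, StrictMonoOn f F := by
  refine ⟨fun q => ((hF.toFinset.filter (· < q)).card : ℤ), fun a ha b _ hab => ?_⟩
  dsimp only
  rw [Nat.cast_lt]
  refine Finset.card_lt_card (Finset.ssubset_iff_of_subset ?_ |>.2 ⟨a, ?_, ?_⟩)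
  · intro x hx
    simp only [Finset.mem_filter] at hx ⊢
    exact ⟨hx.1, hx.2.trans hab⟩
  · simp [ha, hab]
  · simp

theorem isBendGraph_two_of_zigzags {V : Type*} [Finite V] {G : SimpleGraph V} (p : V → Zigzag ℚ)
    (hp : ∀ v, (p v).Proper)
    (hG : ∀ u v, u ≠ v → (G.Adj u v ↔ ((p u).cells ∩ (p v).cells).Nonempty)) :
    IsBendGraph 2 G := by
  let F : Set ℚ := ⋃ v, {(p v).c, (p v).s, (p v).r, (p v).d, (p v).t}
  have hF : F.Finite := Set.finite_iUnion fun v => Set.toFinite _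
  have hin : ∀ v, (p v).IsIn F := fun v => by
    refine ⟨?_, ?_, ?_, ?_, ?_⟩ <;> exact Set.mem_iUnion.2 ⟨v, by simp⟩
  obtain ⟨f, hf⟩ := exists_strictMonoOn_int hF
  choose P hP hP' using fun v => ((hp v).map hf (hin v)).exists_gridPath
  refine ⟨⟨P, fun u v huv => ?_⟩, hP⟩
  rw [hG u v huv, ← Zigzag.inter_map_nonempty hf (hin u) (hin v)]
  simp only [hP']
  constructor
  · rintro ⟨z, hz, hz'⟩
    exact ⟨_, ⟨z, hz, rfl⟩, ⟨z, hz', rfl⟩⟩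
  · rintro ⟨_, ⟨z, hz, rfl⟩, ⟨z', hz', h⟩⟩
    obtain rfl := gridEdge_injective h
    exact ⟨z, hz, hz'⟩

/-! ### Layouts with room at every linked pair. -/

section Layout

variable {W : Type*}

open Classical in
/-- The vertices in `S` are represented by zigzags, and there is room for further vertices at every
pair in `H`. -/
def HasLayout (G : SimpleGraph W) (S : Set W) (H : Set (W × W)) : Prop :=
  ∃ (p : W → Zigzag ℚ) (own : Bool × ℚ × ℚ → W × W),
    (∀ v ∈ S, (p v).Proper) ∧
    (∀ u ∈ S, ∀ v ∈ S, u ≠ v → (G.Adj u v ↔ ((p u).cells ∩ (p v).cells).Nonempty)) ∧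
    ∀ e ∈ H, e.1 ∈ S ∧ e.2 ∈ S ∧ e.1 ≠ e.2 ∧ IsRoomy (fun v => (p v).cells) S own e e.1 e.2

theorem finite_not_isFresh {S : Set W} (hS : S.Finite) (p : W → Zigzag ℚ) (o : Bool) :
    {l | ¬ IsFresh (fun v => (p v).cells) S o l}.Finite := by
  refine (hS.biUnion fun v _ => Set.toFinite {(p v).c, (p v).r, (p v).d}).subset ?_
  intro l hl
  simp only [IsFresh, Set.mem_ofPred_eq, not_forall, not_not] at hl
  obtain ⟨v, hv, z, hz⟩ := hl
  refine Set.mem_biUnion hv ?_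
  rcases mem_cells_iff.1 hz with ⟨-, h, -⟩ | ⟨-, h, -⟩ | ⟨-, h, -⟩ <;> simp [h]

/-- Each pair in `H` serves as its own label. A room at a pair other than `(u, x)` thus consists of
occupied cells with another label, which the extension leaves alone. -/
theorem HasLayout.add_vertex {G : SimpleGraph W} {S : Set W} {H : Set (W × W)} (hL : HasLayout G S H)
    (hS : S.Finite) {y u x : W} (hy : y ∉ S) (hux : (u, x) ∈ H)
    (hadj : ∀ v ∈ S, G.Adj y v → v = u ∨ v = x) :
    HasLayout G (insert y S) (insert (u, y) (insert (x, y) H)) := by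
  classical
  obtain ⟨p, own, h1, h2, h3⟩ := hL
  obtain ⟨hu, hx, hne, hroom⟩ := h3 _ hux
  dsimp only at hu hx hne hroom
  have hvy : ∀ v ∈ S, v ≠ y := fun v hv e => hy (e ▸ hv)
  obtain ⟨P, own', hP, hown, hcells, hr, hr₁, hr₂⟩ :=
    hroom.isExtendable (finite_not_isFresh hS p) hy hu hx hne {v | v ∈ S ∧ G.Adj y v}
      (fun v hv => hadj v hv.1 hv.2) (u, y) (x, y)
  have hC : (fun v => (Function.update p y P v).cells) =
      Function.update (fun v => (p v).cells) y P.cells := by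
    funext v
    by_cases h : v = y
    · subst h; simp
    · simp [h]
  have hadj' : ∀ v ∈ S, (G.Adj y v ↔ (P.cells ∩ (p v).cells).Nonempty) := fun v hv => by
    rw [hcells v hv]
    simp [hv]
  refine ⟨Function.update p y P, own', ?_, ?_, ?_⟩
  · rintro v (rfl | hv)
    · simpa using hP
    · simpa [hvy v hv] using h1 v hv
  · rintro v (rfl | hv) w (rfl | hw) hvw
    · exact absurd rfl hvw
    · simpa [hvy w hw] using hadj' w hw
    · rw [G.adj_comm, Set.inter_comm]
      simpa [hvy v hv] using hadj' v hv
    · simpa [hvy v hv, hvy w hw] using h2 v hv w hw hvw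
  · rw [hC]
    rintro e (rfl | rfl | he)
    · exact ⟨.inr hu, .inl rfl, hvy u hu, hr₁⟩
    · exact ⟨.inr hx, .inl rfl, hvy x hx, hr₂⟩
    · obtain ⟨he1, he2, he3, he4⟩ := h3 e he
      refine ⟨.inr he1, .inr he2, he3, ?_⟩
      by_cases heq : e = (u, x)
      · subst heq
        exact hr
      · refine he4.update hy he1 he2 fun z hz hz' => ?_
        have := hown z (by rw [hz]; exact heq) hz'
        rwa [hz] at this

theorem hasLayout_pair {G : SimpleGraph W} {u x : W} (hux : u ≠ x) (h : ¬ G.Adj u x) :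
    HasLayout G {u, x} {(u, x)} := by
  classical
  -- Two disjoint zigzags that face each other at the positions `[0, 1)` of the lines `0` and `5`.
  let P : Zigzag ℚ := ⟨true, 0, 0, 2, 1, 3⟩
  let Q : Zigzag ℚ := ⟨true, 5, 0, 1, 6, 2⟩
  have hP : ∀ o l z, (o, l, z) ∈ P.cells ↔ (o = true ∧ l = 0 ∧ 0 ≤ z ∧ z < 2) ∨
      (o = false ∧ l = 2 ∧ 0 ≤ z ∧ z < 1) ∨ (o = true ∧ l = 1 ∧ 2 ≤ z ∧ z < 3) := by
    intro o l z
    rw [mem_cells_iff]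
    norm_num
  have hQ : ∀ o l z, (o, l, z) ∈ Q.cells ↔ (o = true ∧ l = 5 ∧ 0 ≤ z ∧ z < 1) ∨
      (o = false ∧ l = 1 ∧ 5 ≤ z ∧ z < 6) ∨ (o = true ∧ l = 6 ∧ 1 ≤ z ∧ z < 2) := by
    intro o l z
    rw [mem_cells_iff]
    norm_num
  have hPQ : ¬ (P.cells ∩ Q.cells).Nonempty := by
    rintro ⟨⟨o, l, z⟩, h1, h2⟩
    rw [hP] at h1
    rw [hQ] at h2
    rcases h1 with ⟨h1, rfl, -⟩ | ⟨h1, rfl, -⟩ | ⟨h1, rfl, -⟩ <;> norm_num [h1] at h2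
  refine ⟨Function.update (fun _ => Q) u P, fun _ => (u, x), ?_, ?_, ?_⟩
  · have h1 : P.Proper := by norm_num [Zigzag.Proper, P]
    have h2 : Q.Proper := by norm_num [Zigzag.Proper, Q]
    rintro v (rfl | rfl)
    · simpa using h1
    · simpa [hux.symm] using h2
  · rintro v (rfl | rfl) w (rfl | rfl) hvw
    · exact absurd rfl hvw
    · simpa [hvw.symm, h] using hPQ
    · rw [G.adj_comm, Set.inter_comm]
      simpa [hvw, h] using hPQ
    · exact absurd rfl hvw
  · rintro _ rfl
    refine ⟨.inl rfl, .inr rfl, hux, .inl ⟨true, 0, 5, 0, 1, ⟨zero_lt_one, ?_⟩,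
      ⟨zero_lt_one, ?_⟩⟩⟩ <;> refine fun z hz hz' => ⟨rfl, ?_⟩
    · rintro v (rfl | rfl)
      · simp only [Function.update_self, hP, Set.mem_singleton_iff, iff_true]
        exact .inl ⟨trivial, trivial, hz, by linarith⟩
      · simp [hux.symm, hQ]
    · rintro v (rfl | rfl)
      · simp [hux, hP]
      · simp [hux.symm, hQ, hz, hz']

end Layout

/-! ### Adding the vertices of a bag. -/

section Bags

variable {V : Type*}

/-- The two vertices form one of the pairs in `H`, in one of the two orders. -/
def IsLinked {W : Type*} (H : Set (W × W)) (u v : W) : Prop := (u, v) ∈ H ∨ (v, u) ∈ H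

theorem IsLinked.mono {W : Type*} {H H' : Set (W × W)} (h : H ⊆ H') {u v : W}
    (hl : IsLinked H u v) : IsLinked H' u v := hl.imp (@h _) (@h _)

theorem IsLinked.symm {W : Type*} {H : Set (W × W)} {u v : W} (hl : IsLinked H u v) :
    IsLinked H v u := hl.elim .inr .inl

/-- A layout of the vertices in `S` together with two isolated auxiliary vertices. -/
structure IsPartialLayout (G : SimpleGraph V) (S : Set V) (H : Set ((V ⊕ Bool) × (V ⊕ Bool))) :
    Prop where
  hasLayout : HasLayout (G ⊕g (⊥ : SimpleGraph Bool)) (Sum.inl '' S ∪ Set.range Sum.inr) H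
  linked_inr : IsLinked H (.inr true) (.inr false)
  exists_linked : ∀ v ∈ S, ∃ w, IsLinked H (.inl v) w

theorem exists_isPartialLayout_empty (G : SimpleGraph V) : ∃ H, IsPartialLayout G ∅ H := by
  refine ⟨{(.inr true, .inr false)}, ?_, .inl (Set.mem_singleton _), by simp⟩
  have h : (Sum.inl '' (∅ : Set V) ∪ Set.range Sum.inr : Set (V ⊕ Bool)) =
      {.inr true, .inr false} := by
    ext (v | b)
    · simp
    · cases b <;> simp
  rw [h]
  exact hasLayout_pair (by simp) (by simp)

theorem IsPartialLayout.add_vertex [Finite V] {G : SimpleGraph V} {S : Set V}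
    {H : Set ((V ⊕ Bool) × (V ⊕ Bool))} (hL : IsPartialLayout G S H) {y : V} (hy : y ∉ S)
    {u x : V ⊕ Bool} (hux : IsLinked H u x)
    (hadj : ∀ v ∈ S, G.Adj y v → .inl v = u ∨ .inl v = x) :
    ∃ H', H ⊆ H' ∧ IsPartialLayout G (insert y S) H' ∧ IsLinked H' u (.inl y) ∧
      IsLinked H' x (.inl y) := by
  wlog hux' : (u, x) ∈ H generalizing u x
  · obtain ⟨H', h1, h2, h3, h4⟩ := this hux.symm (fun v hv h => (hadj v hv h).symm)
      (hux.resolve_left hux')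
    exact ⟨H', h1, h2, h4, h3⟩
  have hsub : H ⊆ insert (u, .inl y) (insert (x, .inl y) H) := fun e he => .inr (.inr he)
  refine ⟨_, hsub, ⟨?_, hL.linked_inr.mono hsub, ?_⟩, .inl (.inl rfl), .inl (.inr (.inl rfl))⟩
  · rw [Set.image_insert_eq, Set.insert_union]
    refine hL.hasLayout.add_vertex (Set.toFinite _) (by simpa using hy) hux' ?_
    rintro (v | b) hv h
    · exact hadj v (by simpa using hv) (by simpa using h)
    · simp at h
  · rintro v (rfl | hv)
    · exact ⟨u, .inr (.inl rfl)⟩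
    · exact (hL.exists_linked v hv).imp fun w hw => hw.mono hsub

/-- The vertices of a set of at most two linked vertices are contained in a pair in `H`. -/
theorem IsPartialLayout.exists_isLinked {G : SimpleGraph V} {S : Set V}
    {H : Set ((V ⊕ Bool) × (V ⊕ Bool))} (hL : IsPartialLayout G S H) {T : Finset V}
    (hT : T.card ≤ 2) (hTS : ∀ v ∈ T, v ∈ S)
    (hTH : ∀ v ∈ T, ∀ w ∈ T, v ≠ w → IsLinked H (.inl v) (.inl w)) :
    ∃ u x, IsLinked H u x ∧ ∀ v ∈ T, .inl v = u ∨ .inl v = x := by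
  classical
  -- If `T` has fewer than two vertices, a pair is still needed: the auxiliary vertices provide one
  -- for the empty set, and `exists_linked` a partner for a single vertex.
  interval_cases h : T.card
  · rw [Finset.card_eq_zero] at h
    subst h
    exact ⟨_, _, hL.linked_inr, by simp⟩
  · obtain ⟨v, rfl⟩ := Finset.card_eq_one.1 h
    obtain ⟨w, hw⟩ := hL.exists_linked v (hTS v (by simp))
    exact ⟨_, w, hw, by simp⟩
  · obtain ⟨v, w, hvw, rfl⟩ := Finset.card_eq_two.1 h
    exact ⟨_, _, hTH v (by simp) w (by simp) hvw, by simp⟩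

/-- The vertices of a bag of size at most three can be added to a partial layout. -/
theorem IsPartialLayout.union_bag [Finite V] {G : SimpleGraph V} {B : Finset V}
    (hB : B.card ≤ 3) (n : ℕ) {S : Set V} {H : Set ((V ⊕ Bool) × (V ⊕ Bool))}
    (hL : IsPartialLayout G S H) (hn : (↑B \ S).ncard = n)
    (hBS : ∀ v ∈ B, ∀ w ∈ B, v ∈ S → w ∈ S → v ≠ w → IsLinked H (.inl v) (.inl w))
    (hadj : ∀ y ∈ B, y ∉ S → ∀ v ∈ S, G.Adj y v → v ∈ B) :
    ∃ H', H ⊆ H' ∧ IsPartialLayout G (S ∪ B) H' ∧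
      ∀ v ∈ B, ∀ w ∈ B, v ≠ w → IsLinked H' (.inl v) (.inl w) := by
  classical
  induction n generalizing S H with
  | zero =>
    have hsub : (B : Set V) ⊆ S :=
      Set.sdiff_eq_empty.1 ((Set.ncard_eq_zero (Set.toFinite _)).1 hn)
    refine ⟨H, subset_rfl, by rwa [Set.union_eq_left.2 hsub], fun v hv w hw => ?_⟩
    exact hBS v hv w hw (hsub hv) (hsub hw)
  | succ n ih =>
    obtain ⟨y, hyB, hyS⟩ : (↑B \ S : Set V).Nonempty :=
      Set.nonempty_of_ncard_ne_zero (by omega)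
    have hyB : y ∈ B := hyB
    -- The vertex `y` of the bag is not yet placed, so at most two of the at most three are.
    have hT : (B.filter (· ∈ S)).card ≤ 2 := by
      have : B.filter (· ∈ S) ⊆ B.erase y := fun v hv => by
        rw [Finset.mem_filter] at hv
        exact Finset.mem_erase.2 ⟨fun e => hyS (e ▸ hv.2), hv.1⟩
      have := Finset.card_le_card this
      rw [Finset.card_erase_of_mem hyB] at this
      omega
    obtain ⟨u, x, hux, hTux⟩ := hL.exists_isLinked hT (by simp) (by
      simp only [Finset.mem_filter]
      exact fun v hv w hw => hBS v hv.1 w hw.1 hv.2 hw.2)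
    obtain ⟨H₁, hH₁, hL₁, hu, hx⟩ := hL.add_vertex hyS hux
      fun v hv h => hTux v (Finset.mem_filter.2 ⟨hadj y hyB hyS v hv h, hv⟩)
    have hlink : ∀ v ∈ B, v ∈ S → IsLinked H₁ (.inl v) (.inl y) := by
      intro v hv hvS
      rcases hTux v (Finset.mem_filter.2 ⟨hv, hvS⟩) with h | h
      · rwa [h]
      · rwa [h]
    obtain ⟨H₂, hH₂, hL₂, h₂⟩ := ih hL₁ (by
      have : (↑B \ S : Set V) = insert y (↑B \ insert y S) := by
        ext v
        by_cases h : v = y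
        · subst h; simp [hyB, hyS]
        · simp [h]
      rw [this, Set.ncard_insert_of_notMem (by simp)] at hn
      omega) (by
      rintro v hv w hw (rfl | hvS) (rfl | hwS) hvw
      · exact absurd rfl hvw
      · exact (hlink w hw hwS).symm
      · exact hlink v hv hvS
      · exact (hBS v hv w hw hvS hwS hvw).mono hH₁) (by
      rintro z hz hzS v (rfl | hv) h
      · exact hyB
      · exact hadj z hz (fun e => hzS (.inr e)) v hv h)
    refine ⟨H₂, hH₁.trans hH₂, ?_, h₂⟩
    have : S ∪ (B : Set V) = insert y S ∪ B := by
      rw [Set.insert_union, Set.insert_eq_of_mem]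
      exact .inr hyB
    rwa [this]

end Bags

/-! ### Walks in trees. -/

section Trees

open SimpleGraph

theorem SimpleGraph.Preconnected.exists_walk_induce {α : Type*} {T : SimpleGraph α} {A : Set α}
    (h : (T.induce A).Preconnected) {a b : α} (ha : a ∈ A) (hb : b ∈ A) :
    ∃ w : T.Walk a b, ∀ c ∈ w.support, c ∈ A := by
  obtain ⟨w⟩ := h ⟨a, ha⟩ ⟨b, hb⟩
  let f : T.induce A →g T := (Embedding.induce A).toHom
  refine ⟨w.map f, fun c hc => ?_⟩
  have hc : c ∈ (w.map f).support := hc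
  rw [Walk.support_map] at hc
  obtain ⟨c, -, rfl⟩ := List.mem_map.1 hc
  exact c.2

/-- In a tree, a walk between the two sides of an edge passes the edge. -/
theorem SimpleGraph.IsAcyclic.mem_edges {α : Type*} {T : SimpleGraph α} (hT : T.IsAcyclic)
    {i j k m : α} (hij : T.Adj i j) (w₁ : T.Walk i k) (h₁ : j ∉ w₁.support) (w₂ : T.Walk m j)
    (h₂ : i ∉ w₂.support) (w : T.Walk k m) : s(i, j) ∈ w.edges := by
  have hb := isBridge_iff_forall_walk_mem_edges.1 (isAcyclic_iff_forall_isBridge.1 hT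
    (T.mem_edgeSet.2 hij)) (w₁.append (w.append w₂))
  simp only [Walk.edges_append, List.mem_append] at hb
  rcases hb with h | h | h
  · exact absurd (w₁.snd_mem_support_of_mem_edges h) h₁
  · exact h
  · exact absurd (w₂.fst_mem_support_of_mem_edges h) h₂

end Trees

/-! ### Growing a layout along a tree decomposition. -/

section Decomposition

open SimpleGraph

variable {V : Type*} {G : SimpleGraph V}

/-- The vertices in the bags of the nodes in `N`. -/
def TreeDecomposition.union (D : TreeDecomposition G) (N : Set D.Node) : Set V :=
  ⋃ i ∈ N, (D.bag i : Set V)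

theorem TreeDecomposition.mem_union {D : TreeDecomposition G} {N : Set D.Node} {v : V} :
    v ∈ D.union N ↔ ∃ i ∈ N, v ∈ D.bag i := by
  simp [TreeDecomposition.union]

/-- A partial layout of the vertices in the bags of the nodes in `N`. -/
def TreeDecomposition.HasLayout (D : TreeDecomposition G) (N : Set D.Node) : Prop :=
  ∃ H, IsPartialLayout G (D.union N) H ∧
    ∀ i ∈ N, ∀ v ∈ D.bag i, ∀ w ∈ D.bag i, v ≠ w → IsLinked H (.inl v) (.inl w)

theorem TreeDecomposition.union_insert (D : TreeDecomposition G) (N : Set D.Node) (i : D.Node) :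
    D.union (insert i N) = D.union N ∪ D.bag i := by
  simp [TreeDecomposition.union, Set.union_comm]

theorem TreeDecomposition.hasLayout_singleton [Finite V] (D : TreeDecomposition G)
    (hD : ∀ i, (D.bag i).card ≤ 3) (i : D.Node) : D.HasLayout {i} := by
  obtain ⟨H, hH⟩ := exists_isPartialLayout_empty G
  obtain ⟨H', -, h1, h2⟩ := hH.union_bag (hD i) _ rfl (by simp) (by simp)
  refine ⟨H', ?_, ?_⟩
  · simpa [TreeDecomposition.union] using h1
  · rintro _ rfl
    exact h2

theorem TreeDecomposition.HasLayout.add_node [Finite V] {D : TreeDecomposition G}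
    (hD : ∀ i, (D.bag i).card ≤ 3) {N : Set D.Node} (hN : (D.tree.induce N).Preconnected)
    (hL : D.HasLayout N) {i j : D.Node} (hi : i ∉ N) (hj : j ∈ N) (hij : D.tree.Adj i j) :
    D.HasLayout (insert i N) := by
  obtain ⟨H, hH, hlink⟩ := hL
  have hpass : ∀ k m, m ∈ N → (∃ w : D.tree.Walk i k, j ∉ w.support) →
      ∀ w : D.tree.Walk k m, s(i, j) ∈ w.edges := by
    rintro k m hm ⟨w₁, h₁⟩ w
    obtain ⟨w₂, h₂⟩ := Preconnected.exists_walk_induce hN hm hj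
    exact D.isTree.isAcyclic.mem_edges hij w₁ h₁ w₂ (fun h => hi (h₂ i h)) w
  -- The nodes whose bags contain `v` are connected and occur both at `i` and in `N`, so they
  -- include `j`. Hence the placed vertices of the new bag are already pairwise linked.
  have hbag : ∀ v ∈ D.bag i, v ∈ D.union N → v ∈ D.bag j := by
    intro v hv hvN
    obtain ⟨m, hm, hvm⟩ := D.mem_union.1 hvN
    obtain ⟨w, hw⟩ := Preconnected.exists_walk_induce (D.connected v).preconnected
      (show i ∈ {i | v ∈ D.bag i} from hv) (show m ∈ {i | v ∈ D.bag i} from hvm)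
    exact hw j (w.snd_mem_support_of_mem_edges
      (hpass i m hm ⟨.nil, by simpa using hij.ne'⟩ w))
  obtain ⟨H', hHH', h1, h2⟩ := hH.union_bag (hD i) _ rfl
    (fun v hv w hw hvN hwN => hlink j hj v (hbag v hv hvN) w (hbag w hw hwN)) (by
      -- Some bag `k` contains both `y` and `v`. As `y` is not yet placed, its nodes avoid `j`, so
      -- `k` is on the side of `i`; the nodes of `v` lead from `k` into `N` and hence pass `i`.
      intro y hy hyN v hvN hyv
      obtain ⟨m, hm, hvm⟩ := D.mem_union.1 hvN
      obtain ⟨k, hyk, hvk⟩ := D.exists_mem_bag_of_adj y v hyv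
      obtain ⟨w₁, hw₁⟩ := Preconnected.exists_walk_induce (D.connected y).preconnected
        (show i ∈ {i | y ∈ D.bag i} from hy) (show k ∈ {i | y ∈ D.bag i} from hyk)
      obtain ⟨w, hw⟩ := Preconnected.exists_walk_induce (D.connected v).preconnected
        (show k ∈ {i | v ∈ D.bag i} from hvk) (show m ∈ {i | v ∈ D.bag i} from hvm)
      exact hw i (w.fst_mem_support_of_mem_edges
        (hpass k m hm ⟨w₁, fun h => hyN (D.mem_union.2 ⟨j, hj, hw₁ j h⟩)⟩ w)))
  refine ⟨H', by rwa [D.union_insert], ?_⟩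
  rintro n (rfl | hn)
  · exact h2
  · exact fun v hv w hw hvw => (hlink n hn v hv w hw hvw).mono hHH'

theorem SimpleGraph.Preconnected.induce_insert {α : Type*} {T : SimpleGraph α} {N : Set α}
    (hN : (T.induce N).Preconnected) {i j : α} (hj : j ∈ N) (hij : T.Adj i j) :
    (T.induce (insert i N)).Preconnected := by
  have hsub : N ⊆ insert i N := Set.subset_insert i N
  have key : ∀ a : (insert i N : Set α), (T.induce (insert i N)).Reachable a ⟨j, hsub hj⟩ := by
    rintro ⟨a, rfl | ha⟩
    · exact Adj.reachable (by simpa using hij)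
    · exact (hN ⟨a, ha⟩ ⟨j, hj⟩).map (T.induceHomOfLE hsub).toHom
  exact fun a b => (key a).trans (key b).symm

theorem TreeDecomposition.hasLayout_univ [Finite V] (D : TreeDecomposition G)
    (hD : ∀ i, (D.bag i).card ≤ 3) : D.HasLayout Set.univ := by
  have := D.finite_node
  suffices h : ∀ n, ∀ N : Set D.Node, N.Nonempty → (D.tree.induce N).Preconnected →
      D.HasLayout N → Nᶜ.ncard = n → D.HasLayout Set.univ by
    obtain ⟨r⟩ := D.isTree.connected.nonempty
    refine h _ {r} ⟨r, rfl⟩ ?_ (D.hasLayout_singleton hD r) rfl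
    rintro ⟨a, rfl⟩ ⟨b, rfl⟩
    exact .rfl
  intro n
  induction n with
  | zero =>
    intro N _ _ hL hn
    rw [Set.ncard_eq_zero (Set.toFinite _), Set.compl_empty_iff] at hn
    rwa [← hn]
  | succ n ih =>
    intro N hne hN hL hn
    obtain ⟨b, hb⟩ := Set.nonempty_of_ncard_ne_zero (s := Nᶜ) (by omega)
    obtain ⟨a, ha⟩ := hne
    obtain ⟨w⟩ := D.isTree.connected.preconnected a b
    -- The next node is the outer end of an edge along which a walk to a missing node leaves `N`;
    -- this keeps `N` connected.
    obtain ⟨d, -, hd1, hd2⟩ := w.exists_boundary_dart N ha hb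
    refine ih (insert d.snd N) ⟨a, .inr ha⟩ (hN.induce_insert hd1 d.adj.symm)
      (hL.add_node hD hN hd2 hd1 d.adj.symm) ?_
    have : Nᶜ = insert d.snd (insert d.snd N)ᶜ := by
      ext c
      by_cases h : c = d.snd
      · simp [h, hd2]
      · simp [h]
    rw [this, Set.ncard_insert_of_notMem (by simp)] at hn
    omega

theorem TreeDecomposition.isBendGraph_two [Finite V] (D : TreeDecomposition G)
    (hD : ∀ i, (D.bag i).card ≤ 3) : IsBendGraph 2 G := by
  obtain ⟨H, hH, -⟩ := D.hasLayout_univ hD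
  obtain ⟨p, own, h1, h2, -⟩ := hH.hasLayout
  have hmem : ∀ v : V, Sum.inl v ∈ (Sum.inl '' D.union Set.univ ∪ Set.range Sum.inr :
      Set (V ⊕ Bool)) := fun v => .inl ⟨v, D.mem_union.2 (by simpa using D.exists_mem_bag v), rfl⟩
  -- The auxiliary vertices are now dropped.
  refine isBendGraph_two_of_zigzags (fun v => p (.inl v)) (fun v => h1 _ (hmem v)) fun u v huv => ?_
  rw [← h2 _ (hmem u) _ (hmem v) (by simpa using huv)]
  simp

theorem exists_treeDecomposition_of_treewidth_le {k : ℕ}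
    (hG : treewidth G ≤ k) : ∃ D : TreeDecomposition G, ∀ i, (D.bag i).card ≤ k + 1 := by
  by_contra! h
  have : (k + 1 : ℕ) ≤ treewidth G := by
    refine le_iInf fun D => ?_
    obtain ⟨i, hi⟩ := h D
    refine le_trans ?_ (le_iSup (fun i : D.Node => (((D.bag i).card - 1 : ℕ) : ℕ∞)) i)
    -- The bag has more than `k + 1` vertices, so the truncated subtraction does no harm.
    exact_mod_cast (by omega : k + 1 ≤ (D.bag i).card - 1)
  have := this.trans hG
  rw [Nat.cast_le] at this
  omega

end Decomposition

theorem theorem1 {V : Type*} [Finite V] (G : SimpleGraph V) (hG : treewidth G ≤ 2) :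
    bendNumber G ≤ 2 := by
  obtain ⟨D, hD⟩ := exists_treeDecomposition_of_treewidth_le (k := 2) (by exact_mod_cast hG)
  exact iInf₂_le (f := fun (k : ℕ) (_ : IsBendGraph k G) => (k : ℕ∞)) 2 (D.isBendGraph_two hD)
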